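/- All Hilbert spaces are complex. For a C*-algebra $A$, the character density $\chi(A)$ is the smallest cardinality of a dense subset of $A$; for a Hilbert space $H$, $\chi(H)$ likewise denotes the smallest cardinality of a dense subset of $H$. The representation density $\mathrm{rd}(A)$ is the smallest cardinal $\chi(H)$, where $H$ is a Hilbert space on which $A$ can be faithfully represented. For a family $\{A_x\}_{x\in X}$ of unital C*-algebras, indexed by an arbitrary set $X$, the (maximal) tensor product $\bigotimes_{x\in X}A_x$ is the unital C*-algebra containing isomorphic copies of the $A_x$ as unital subalgebras such that (1) for distinct $x,y\in X$ every element of $A_x$ commutes with every element of $A_y$, and $\bigcup_{x\in X}A_x$ generates $\bigotimes_{x\in X}A_x$ as a unital C*-algebra; and (2) for every unital C*-algebra $B$ and every family of unital $*$-homomorphisms $\varphi_x\colon A_x\to B$ whose ranges mutually commute, there is a unital $*$-homomorphism $\varphi\colon\bigotimes_{x\in X}A_x\to B$ with $\varphi\restriction_{A_x}=\varphi_x$ for all $x\in X$. A full matrix algebra is a C*-algebra isomorphic to $M_n(\mathbb{C})$ for some $n\ge 1$, and a UHF algebra is a C*-algebra isomorphic to a tensor product of a (possibly uncountable) family of full matrix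 algebras. (a) Let $\{A_x\}_{x\in X}$ be a family of nonabelian unital C*-algebras and let $A=\bigotimes_{x\in X}A_x$. Then $\mathrm{rd}(A)\ge |X|$. (b) If $A$ is a UHF algebra, then $\chi(A)=\mathrm{rd}(A)$. -/

import Mathlib

open Cardinal

universe u v w

/-- The character density of a topological space (applied below to C*-algebras and to Hilbert
spaces): the smallest cardinality of a dense subset. -/
noncomputable def characterDensity (S : Type u) [TopologicalSpace S] : Cardinal.{u} :=
  sInf {c : Cardinal.{u} | ∃ D : Set S, Dense D ∧ #D = c}

/-- The representation density of a C*-algebra `A`: the smallest character density of a complex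
Hilbert space `H` on which `A` has a faithful (that is, injective, possibly degenerate)
`*`-representation. Hilbert spaces in the universe of `A` suffice: `A` is faithfully represented
on one whose character density is at most that of `A`, and a Hilbert space is determined up to
isomorphism by the cardinality of an orthonormal basis. -/
noncomputable def representationDensity (A : Type u) [NonUnitalCStarAlgebra A] :
    Cardinal.{u} :=
  sInf {c : Cardinal.{u} |
    ∃ (H : Type u) (_ : NormedAddCommGroup H) (_ : InnerProductSpace ℂ H) (_ : CompleteSpace H)
      (π : A →⋆ₙₐ[ℂ] (H →L[ℂ] H)), Function.Injective π ∧ characterDensity H = c}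

/-- A family of unital `*`-homomorphisms into one algebra has mutually commuting ranges. -/
def MutuallyCommute {X : Type u} {A : X → Type v} [∀ x, CStarAlgebra (A x)]
    {B : Type w} [CStarAlgebra B] (φ : ∀ x, A x →⋆ₐ[ℂ] B) : Prop :=
  ∀ x y : X, x ≠ y → ∀ (a : A x) (b : A y), φ x a * φ y b = φ y b * φ x a

/-- `T`, with the unital embeddings `ι x : A x → T`, is the (maximal) tensor product of the family
`A` of unital C*-algebras. The test algebras `B` may be taken in any universe that contains copies
of `X` and of the `A x`, because the C*-subalgebra of `B` generated by the ranges of the `φ x` is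
bounded in size by the family. For empty `X` this says that `T` is `ℂ`. -/
structure IsCStarTensorProduct {X : Type u} {A : X → Type v}
    [∀ x, CStarAlgebra (A x)] {T : Type w} [CStarAlgebra T] (ι : ∀ x, A x →⋆ₐ[ℂ] T) : Prop where
  /-- each `A x` is (isomorphic to) a unital subalgebra of `T` -/
  injective : ∀ x, Function.Injective (ι x)
  /-- these subalgebras mutually commute -/
  commute : MutuallyCommute ι
  /-- their union generates `T` as a unital C*-algebra -/
  generates : (StarAlgebra.adjoin ℂ (⋃ x, Set.range (ι x))).topologicalClosure = ⊤
  /-- the universal property -/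
  universal : ∀ (B : Type (max u v w)) [CStarAlgebra B] (φ : ∀ x, A x →⋆ₐ[ℂ] B),
    MutuallyCommute φ → ∃ Φ : T →⋆ₐ[ℂ] B, ∀ x, Φ.comp (ι x) = φ x

/-- A full matrix algebra: a C*-algebra isomorphic to `M_n(ℂ)` for some `n ≥ 1`. -/
def IsFullMatrixAlgebra (M : Type u) [CStarAlgebra M] : Prop :=
  ∃ n : ℕ, 1 ≤ n ∧ Nonempty (M ≃⋆ₐ[ℂ] Matrix (Fin n) (Fin n) ℂ)

/-- A UHF algebra: a tensor product of a (possibly uncountable) family of full matrix algebras. -/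
def IsUHF (A : Type w) [CStarAlgebra A] : Prop :=
  ∃ (X : Type u) (M : X → Type v) (_ : ∀ x, CStarAlgebra (M x)) (ι : ∀ x, M x →⋆ₐ[ℂ] A),
    (∀ x, IsFullMatrixAlgebra (M x)) ∧ IsCStarTensorProduct ι

theorem characterDensity_le {S : Type u} [TopologicalSpace S] {D : Set S} (hD : Dense D) :
    characterDensity S ≤ #D :=
  csInf_le' ⟨D, hD, rfl⟩

theorem exists_dense_mk_eq_characterDensity (S : Type u) [TopologicalSpace S] :
    ∃ D : Set S, Dense D ∧ #D = characterDensity S :=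
  csInf_mem (s := {c : Cardinal.{u} | ∃ D : Set S, Dense D ∧ #D = c})
    ⟨_, Set.univ, dense_univ, rfl⟩

theorem Dense.infinite_of_nontrivial {E : Type u} [NormedAddCommGroup E] [NormedSpace ℂ E]
    [Nontrivial E] {D : Set E} (hD : Dense D) : D.Infinite := by
  intro hfin
  have : D = Set.univ := by rw [← hD.closure_eq, hfin.isClosed.closure_eq]
  have := Module.Free.infinite ℂ E
  exact Set.infinite_univ (‹D = Set.univ› ▸ hfin)

theorem aleph0_le_characterDensity (E : Type u) [NormedAddCommGroup E] [NormedSpace ℂ E]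
    [Nontrivial E] : ℵ₀ ≤ characterDensity E := by
  obtain ⟨D, hD, h⟩ := exists_dense_mk_eq_characterDensity E
  rw [← h, Cardinal.aleph0_le_mk_iff, Set.infinite_coe_iff]
  exact hD.infinite_of_nontrivial

@[to_additive]
theorem Submonoid.mk_closure_le {M : Type u} [Monoid M] (s : Set M) :
    #(Submonoid.closure s) ≤ max #s ℵ₀ := by
  rw [Submonoid.closure_eq_mrange]
  calc #(MonoidHom.mrange (FreeMonoid.lift ((↑) : s → M)))
      ≤ #(FreeMonoid s) := Cardinal.mk_le_of_surjective (MonoidHom.mrangeRestrict_surjective _)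
    _ ≤ max ℵ₀ #s := Cardinal.mk_list_le_max s
    _ = _ := max_comm _ _

/-- A complex normed space with a total set `S` has character density at most `max #S ℵ₀`. -/
theorem characterDensity_le_of_dense_span {E : Type u} [NormedAddCommGroup E] [NormedSpace ℂ E]
    {S : Set E} (hS : Dense (Submodule.span ℂ S : Set E)) :
    characterDensity E ≤ max #S ℵ₀ := by
  let P : Set E := Set.range fun p : ℕ × S ↦ TopologicalSpace.denseSeq ℂ p.1 • (p.2 : E)
  have hP : #P ≤ max #S ℵ₀ := by
    refine Cardinal.mk_range_le.trans ?_
    rw [Cardinal.mk_prod, Cardinal.mk_nat]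
    refine (Cardinal.mul_le_max _ _).trans (max_le (max_le ?_ ?_) (le_max_right _ _)) <;> simp
  have hmem : ∀ x ∈ Submodule.span ℂ S, x ∈ (AddSubmonoid.closure P).topologicalClosure := by
    intro x hx
    obtain ⟨n, c, g, rfl⟩ := Submodule.mem_span_set'.mp hx
    refine sum_mem fun i _ ↦ ?_
    have hc : c i ∈ closure (Set.range (TopologicalSpace.denseSeq ℂ)) :=
      TopologicalSpace.denseRange_denseSeq ℂ (c i)
    refine map_mem_closure (f := fun z : ℂ ↦ z • (g i : E)) (by fun_prop) hc ?_
    rintro _ ⟨k, rfl⟩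
    exact AddSubmonoid.subset_closure ⟨(k, g i), rfl⟩
  have hdense : Dense (AddSubmonoid.closure P : Set E) := by
    rw [← dense_closure]
    exact hS.mono hmem
  calc characterDensity E ≤ #(AddSubmonoid.closure P) := characterDensity_le hdense
    _ ≤ max #P ℵ₀ := AddSubmonoid.mk_closure_le P
    _ ≤ max #S ℵ₀ := max_le hP (le_max_right _ _)

theorem characterDensity_le_of_adjoin {A : Type u} [CStarAlgebra A] {S : Set A}
    (hS : (StarAlgebra.adjoin ℂ S).topologicalClosure = ⊤) :
    characterDensity A ≤ max #S ℵ₀ := by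
  have hspan : Dense (Submodule.span ℂ (Submonoid.closure (S ∪ star S) : Set A) : Set A) := by
    rw [← Algebra.adjoin_eq_span, dense_iff_closure_eq]
    exact congrArg (fun B : StarSubalgebra ℂ A ↦ (B : Set A)) hS
  have hstar : #(star S : Set A) = #S := by
    rw [← Set.image_star]
    exact Cardinal.mk_image_eq star_injective
  calc characterDensity A ≤ max #(Submonoid.closure (S ∪ star S)) ℵ₀ :=
        characterDensity_le_of_dense_span hspan
    _ ≤ max (max #(S ∪ star S : Set A) ℵ₀) ℵ₀ :=
        max_le_max (Submonoid.mk_closure_le _) le_rfl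
    _ ≤ max #S ℵ₀ := by
        refine max_le (max_le ?_ (le_max_right _ _)) (le_max_right _ _)
        refine (Cardinal.mk_union_le _ _).trans ((Cardinal.add_le_max _ _).trans ?_)
        simp [hstar]

/-- If two operators agree with common approximants on the relevant vectors, then the failure of
commutation of the first one with `b` is small whenever the second one commutes with `b`. -/
theorem norm_commutator_apply_lt {H : Type u} [NormedAddCommGroup H] [NormedSpace ℂ H]
    {a a' b : H →L[ℂ] H} (hcomm : a' * b = b * a') {N δ : ℝ} (hN : 1 ≤ N)
    (ha : ‖a‖ ≤ N) (ha' : ‖a'‖ ≤ N) (hb : ‖b‖ ≤ N) {ξ ζ η θ : H}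
    (h₁ : ‖b ξ - ζ‖ < δ) (h₂ : ‖a ξ - η‖ < δ) (h₃ : ‖a' ξ - η‖ < δ)
    (h₄ : ‖a ζ - θ‖ < δ) (h₅ : ‖a' ζ - θ‖ < δ) :
    ‖(a * b - b * a) ξ‖ < 6 * N * δ := by
  have hδ : 0 < δ := (norm_nonneg _).trans_lt h₁
  have hc : a' (b ξ) = b (a' ξ) := congrArg (fun T : H →L[ℂ] H ↦ T ξ) hcomm
  have key : (a * b - b * a) ξ = a (b ξ - ζ) + (a ζ - θ) - (a' ζ - θ) - a' (b ξ - ζ)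
      + b (a' ξ - η) - b (a ξ - η) := by
    simp only [sub_apply, mul_apply_eq_comp, map_sub, hc]
    abel
  have bound : ∀ (T : H →L[ℂ] H) (v : H), ‖T‖ ≤ N → ‖v‖ < δ → ‖T v‖ ≤ N * δ := fun T v hT hv ↦
    (T.le_opNorm v).trans (mul_le_mul hT hv.le (norm_nonneg _) (by linarith))
  rw [key]
  have e₁ := bound a _ ha h₁
  have e₂ := bound a' _ ha' h₁
  have e₃ := bound b _ hb h₃
  have e₄ := bound b _ hb h₂
  have t₁ := norm_sub_le (a (b ξ - ζ) + (a ζ - θ) - (a' ζ - θ) - a' (b ξ - ζ)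
      + b (a' ξ - η)) (b (a ξ - η))
  have t₂ := norm_add_le (a (b ξ - ζ) + (a ζ - θ) - (a' ζ - θ) - a' (b ξ - ζ)) (b (a' ξ - η))
  have t₃ := norm_sub_le (a (b ξ - ζ) + (a ζ - θ) - (a' ζ - θ)) (a' (b ξ - ζ))
  have t₄ := norm_sub_le (a (b ξ - ζ) + (a ζ - θ)) (a' ζ - θ)
  have t₅ := norm_add_le (a (b ξ - ζ)) (a ζ - θ)
  nlinarith [mul_le_mul_of_nonneg_right hN hδ.le]

/-- A family of operators `a x`, each of which fails to commute with an operator `b x` commuting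
with all the other `a y`, has at most as many members as the character density of the space. -/
theorem lift_mk_le_characterDensity {X : Type u} {H : Type w} [NormedAddCommGroup H]
    [NormedSpace ℂ H] (a b : X → H →L[ℂ] H) (hne : ∀ x, a x * b x ≠ b x * a x)
    (hcomm : ∀ x y, x ≠ y → a y * b x = b x * a y) :
    Cardinal.lift.{w} #X ≤ Cardinal.lift.{u} (characterDensity H) := by
  rcases isEmpty_or_nonempty X with hX | ⟨⟨x₀⟩⟩
  · simp
  have : Nontrivial H := by
    by_contra h
    rw [not_nontrivial_iff_subsingleton] at h
    exact hne x₀ (Subsingleton.elim _ _)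
  obtain ⟨D, hD, hcard⟩ := exists_dense_mk_eq_characterDensity H
  have hinf : ℵ₀ ≤ #D := hcard ▸ aleph0_le_characterDensity H
  have approx : ∀ (v : H) {δ : ℝ}, 0 < δ → ∃ d : D, ‖v - d‖ < δ := by
    intro v δ hδ
    obtain ⟨d, hd, h⟩ := hD.exists_dist_lt v hδ
    exact ⟨⟨d, hd⟩, by rwa [← dist_eq_norm]⟩
  have step : ∀ x, ∃ p : (D × D) × (D × D) × ℕ,
      ‖a x‖ ≤ p.2.2 + 1 ∧ ‖b x‖ ≤ p.2.2 + 1 ∧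
      1 / ((p.2.2 : ℝ) + 1) ≤ ‖(a x * b x - b x * a x) p.1.1‖ ∧
      ‖b x p.1.1 - p.1.2‖ < 1 / (6 * ((p.2.2 : ℝ) + 1) ^ 2) ∧
      ‖a x p.1.1 - p.2.1.1‖ < 1 / (6 * ((p.2.2 : ℝ) + 1) ^ 2) ∧
      ‖a x p.1.2 - p.2.1.2‖ < 1 / (6 * ((p.2.2 : ℝ) + 1) ^ 2) := by
    intro x
    have hξ : ∃ ξ : D, (a x * b x - b x * a x) ξ ≠ 0 := by
      by_contra! h
      refine hne x (sub_eq_zero.mp (DFunLike.coe_injective ?_))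
      exact Continuous.ext_on hD (ContinuousLinearMap.continuous _) continuous_const
        fun d hd ↦ h ⟨d, hd⟩
    obtain ⟨ξ, hξ⟩ := hξ
    obtain ⟨k, hk⟩ := exists_nat_ge (max (max ‖a x‖ ‖b x‖) (‖(a x * b x - b x * a x) ξ‖)⁻¹)
    have hk1 : ‖a x‖ ≤ k := (le_max_left _ _).trans ((le_max_left _ _).trans hk)
    have hk2 : ‖b x‖ ≤ k := (le_max_right _ _).trans ((le_max_left _ _).trans hk)
    have hk3 : (‖(a x * b x - b x * a x) ξ‖)⁻¹ ≤ k := (le_max_right _ _).trans hk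
    have hδ : (0 : ℝ) < 1 / (6 * ((k : ℝ) + 1) ^ 2) := by positivity
    obtain ⟨ζ, hζ⟩ := approx (b x ξ) hδ
    obtain ⟨η, hη⟩ := approx (a x ξ) hδ
    obtain ⟨θ, hθ⟩ := approx (a x ζ) hδ
    refine ⟨((ξ, ζ), (η, θ), k), by simp only; linarith, by simp only; linarith, ?_, hζ, hη, hθ⟩
    rw [one_div]
    exact inv_le_of_inv_le₀ (norm_pos_iff.mpr hξ) (by simp only; linarith)
  choose p hpa hpb hpc h₁ h₂ h₃ using step
  have hinj : Function.Injective p := by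
    intro x y hxy
    by_contra hne'
    have hN : (1 : ℝ) ≤ (p x).2.2 + 1 := by simp
    have h := norm_commutator_apply_lt (hcomm x y hne') hN (hpa x)
      (hxy ▸ hpa y) (hpb x) (h₁ x) (h₂ x) (hxy ▸ h₂ y) (h₃ x) (hxy ▸ h₃ y)
    have e : 6 * (((p x).2.2 : ℝ) + 1) * (1 / (6 * (((p x).2.2 : ℝ) + 1) ^ 2))
        = 1 / (((p x).2.2 : ℝ) + 1) := by
      field_simp
    rw [e] at h
    exact absurd (hpc x) (not_le.mpr h)
  have hle := Cardinal.lift_mk_le_lift_mk_of_injective hinj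
  have hprod : #((D × D) × (D × D) × ℕ) = #D := by
    simp only [Cardinal.mk_prod, Cardinal.lift_id, Cardinal.mk_nat, Cardinal.lift_uzero,
      Cardinal.lift_aleph0, Cardinal.mul_eq_self hinf, Cardinal.mul_aleph0_eq hinf]
  rwa [hprod, hcard] at hle

section Rep

open scoped ComplexOrder InnerProductSpace ComplexStarModule

/-- Every element `d ≠ 0` of a C*-algebra is seen up to the factor `√2` by a positive functional. -/
theorem exists_positiveLinearMap_lt {A : Type u} [CStarAlgebra A] [PartialOrder A]
    [StarOrderedRing A] {d : A} (hd : d ≠ 0) :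
    ∃ f : A →ₚ[ℂ] ℂ, (f 1).re * (‖d‖ ^ 2 / 2) < (f (star d * d)).re := by
  have hx : algebraMap ℝ A (‖d‖ ^ 2 / 2) - star d * d ∉ ProperCone.positive ℝ A := by
    rw [ProperCone.mem_positive, sub_nonneg,
      ← CStarAlgebra.norm_le_iff_le_algebraMap _ (by positivity) (star_mul_self_nonneg d),
      CStarRing.norm_star_mul_self]
    have : 0 < ‖d‖ := norm_pos_iff.mpr hd
    nlinarith
  obtain ⟨g, hg, hgx⟩ := ProperCone.hyperplane_separation_point _ hx
  let φ : A →ₗ[ℂ] ℂ :=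
    { toFun := fun x ↦ ⟨g (ℜ x), g (ℑ x)⟩
      map_add' := fun x y ↦ by apply Complex.ext <;> simp
      map_smul' := fun c x ↦ by
        apply Complex.ext <;>
          simp [realPart_smul, imaginaryPart_smul] }
  have hφ : ∀ x : A, IsSelfAdjoint x → φ x = g x := by
    intro x hx
    apply Complex.ext <;> simp [φ, hx.coe_realPart, hx.imaginaryPart]
  refine ⟨PositiveLinearMap.mk₀ φ fun x hx ↦ ?_, ?_⟩
  · rw [hφ x hx.isSelfAdjoint]
    exact_mod_cast hg x hx
  · change (φ 1).re * _ < (φ _).re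
    rw [hφ _ (.one A), hφ _ (.star_mul_self d)]
    rw [map_sub, Algebra.algebraMap_eq_smul_one, map_smul, sub_neg, smul_eq_mul] at hgx
    simpa [mul_comm] using hgx

variable {ι : Type v} {A : Type u} {G : ι → Type w} [∀ i, NormedAddCommGroup (G i)]
  [∀ i, InnerProductSpace ℂ (G i)]

/-- The diagonal operator of a uniformly bounded family of operators on a Hilbert sum. -/
noncomputable def lp.diagonal (T : ∀ i, G i →L[ℂ] G i) (C : ℝ) (hT : ∀ i, ‖T i‖ ≤ C) :
    lp G 2 →L[ℂ] lp G 2 :=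
  have hle : ∀ (x : lp G 2) (i : ι), ‖T i (x i)‖ ≤ ‖(C • x : lp G 2) i‖ := fun x i ↦
    calc ‖T i (x i)‖ ≤ ‖T i‖ * ‖x i‖ := (T i).le_opNorm _
      _ ≤ C * ‖x i‖ := by gcongr; exact hT i
      _ ≤ ‖(C • x : lp G 2) i‖ := by
        rw [lp.coeFn_smul, Pi.smul_apply, norm_smul]
        gcongr
        exact le_abs_self C
  LinearMap.mkContinuous
    { toFun := fun x ↦ ⟨fun i ↦ T i (x i), (lp.memℓp (C • x)).mono' (hle x)⟩
      map_add' := fun x y ↦ lp.ext (funext fun i ↦ map_add (T i) (x i) (y i))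
      map_smul' := fun c x ↦ lp.ext (funext fun i ↦ map_smul (T i) c (x i)) } |C| fun x ↦ by
    refine (lp.norm_mono (by simp) (hle x)).trans_eq ?_
    rw [norm_smul, Real.norm_eq_abs]

@[simp]
theorem lp.diagonal_apply (T : ∀ i, G i →L[ℂ] G i) (C : ℝ) (hT : ∀ i, ‖T i‖ ≤ C)
    (x : lp G 2) (i : ι) : lp.diagonal T C hT x i = T i (x i) :=
  rfl

/-- The Hilbert sum of a family of representations. -/
noncomputable def directSumRepresentation [NonUnitalCStarAlgebra A]
    [∀ i, CompleteSpace (G i)] (π : ∀ i, A →⋆ₙₐ[ℂ] (G i →L[ℂ] G i)) :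
    A →⋆ₙₐ[ℂ] (lp G 2 →L[ℂ] lp G 2) where
  toFun a := lp.diagonal (fun i ↦ π i a) ‖a‖
    fun i ↦ NonUnitalStarAlgHom.norm_apply_le (π i) a
  map_smul' c a := by ext x i; simp
  map_zero' := by ext x i; simp
  map_add' a b := by ext x i; simp
  map_mul' a b := by ext x i; simp
  map_star' a := by
    refine (ContinuousLinearMap.eq_adjoint_iff _ _).mpr fun x y ↦ ?_
    simp [lp.inner_eq_tsum, map_star, ContinuousLinearMap.star_eq_adjoint,
      ContinuousLinearMap.adjoint_inner_left]

theorem directSumRepresentation_apply [NonUnitalCStarAlgebra A] [∀ i, CompleteSpace (G i)]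
    (π : ∀ i, A →⋆ₙₐ[ℂ] (G i →L[ℂ] G i)) (a : A) (x : lp G 2) (i : ι) : directSumRepresentation π a x i = π i a (x i) :=
  rfl

/-- A Hilbert sum is the closed span of any sets total in the summands. -/
theorem lp.dense_span_iUnion_single [DecidableEq ι] (S : ∀ i, Set (G i))
    (hS : ∀ i, Dense (Submodule.span ℂ (S i) : Set (G i))) :
    Dense (Submodule.span ℂ (⋃ i, lp.single 2 i '' S i) : Set (lp G 2)) := by
  intro x
  set M := (Submodule.span ℂ (⋃ i, lp.single 2 i '' S i)).topologicalClosure with hM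
  change x ∈ M
  have hsingle : ∀ i (v : G i), lp.single 2 i v ∈ M := by
    intro i v
    refine map_mem_closure (lp.isometry_single (E := G) (p := 2) i).continuous (hS i v) ?_
    intro y hy
    induction hy using Submodule.span_induction with
    | mem y hy => exact Submodule.subset_span (Set.mem_iUnion.mpr ⟨i, y, hy, rfl⟩)
    | zero => rw [lp.single_zero]; exact zero_mem _
    | add y z _ _ hy hz => rw [lp.single_add]; exact add_mem hy hz
    | smul c y _ hy => rw [lp.single_smul]; exact Submodule.smul_mem _ c hy
  exact (Submodule.isClosed_topologicalClosure _).mem_of_tendsto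
    (lp.hasSum_single ENNReal.ofNat_ne_top x)
    (Filter.Eventually.of_forall fun s ↦ sum_mem fun i _ ↦ hsingle i _)

/-- The image in the GNS space of a dense subset of the algebra is total. -/
theorem PositiveLinearMap.dense_span_gns {A : Type u} [CStarAlgebra A] [PartialOrder A]
    [StarOrderedRing A] (f : A →ₚ[ℂ] ℂ) {D : Set A} (hD : Dense D) :
    Dense (Submodule.span ℂ ((fun a ↦ (f.toPreGNS a : f.GNS)) '' D) : Set f.GNS) := by
  have hcyc : ∀ a, (f.toPreGNS a : f.GNS)
      = f.gnsNonUnitalStarAlgHom a (f.toPreGNS 1 : f.GNS) := by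
    intro a
    rw [gnsNonUnitalStarAlgHom_apply_coe, leftMulMapPreGNS_apply, ofPreGNS_toPreGNS, mul_one]
  have hcont : Continuous fun a ↦ (f.toPreGNS a : f.GNS) := by
    rw [funext hcyc]
    have h : Continuous f.gnsNonUnitalStarAlgHom :=
      AddMonoidHomClass.continuous_of_bound f.gnsNonUnitalStarAlgHom 1 fun a ↦ by
        simpa using NonUnitalStarAlgHom.norm_apply_le f.gnsNonUnitalStarAlgHom a
    exact h.clm_apply continuous_const
  have hrange : DenseRange fun a ↦ (f.toPreGNS a : f.GNS) :=
    UniformSpace.Completion.denseRange_coe.comp f.toPreGNS.surjective.denseRange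
      (UniformSpace.Completion.continuous_coe _)
  exact (hrange.dense_image hcont hD).mono Submodule.subset_span

/-- The GNS representation of `f` bounds the norm of `d` from below as soon as the state
proportional to `f` does. -/
theorem PositiveLinearMap.norm_le_norm_gns {A : Type u} [CStarAlgebra A] [PartialOrder A]
    [StarOrderedRing A] {f : A →ₚ[ℂ] ℂ} {d : A}
    (h : (f 1).re * (‖d‖ ^ 2 / 2) < (f (star d * d)).re) :
    ‖d‖ ≤ 2 * ‖f.gnsNonUnitalStarAlgHom d‖ := by
  set Ω : f.GNS := (f.toPreGNS 1 : f.GNS)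
  have hΩ : ‖Ω‖ ^ 2 = (f 1).re := by
    have := f.preGNS_norm_sq (f.toPreGNS 1)
    simp only [ofPreGNS_toPreGNS, star_one, one_mul] at this
    rw [UniformSpace.Completion.norm_coe, ← this]
    norm_cast
  have hd : ‖f.gnsNonUnitalStarAlgHom d Ω‖ ^ 2 = (f (star d * d)).re := by
    have := f.preGNS_norm_sq (f.toPreGNS d)
    simp only [ofPreGNS_toPreGNS] at this
    rw [gnsNonUnitalStarAlgHom_apply_coe, UniformSpace.Completion.norm_coe, ← this,
      leftMulMapPreGNS_apply]
    simp only [ofPreGNS_toPreGNS, mul_one]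
    norm_cast
  have hle := (f.gnsNonUnitalStarAlgHom d).le_opNorm Ω
  by_contra! hlt
  rw [← hΩ, ← hd] at h
  have h₁ : ‖f.gnsNonUnitalStarAlgHom d Ω‖ ≤ ‖d‖ / 2 * ‖Ω‖ :=
    hle.trans (by gcongr; linarith)
  have h₂ : ‖f.gnsNonUnitalStarAlgHom d Ω‖ ^ 2 ≤ (‖d‖ / 2 * ‖Ω‖) ^ 2 := by gcongr
  nlinarith [mul_nonneg (sq_nonneg ‖Ω‖) (sq_nonneg ‖d‖)]

/-- A unital C*-algebra is faithfully represented on a Hilbert space whose character density is at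
most that of the algebra, up to `ℵ₀`. -/
theorem exists_faithful_representation (A : Type u) [CStarAlgebra A] :
    ∃ (H : Type u) (_ : NormedAddCommGroup H) (_ : InnerProductSpace ℂ H) (_ : CompleteSpace H)
      (π : A →⋆ₙₐ[ℂ] (H →L[ℂ] H)), Function.Injective π ∧
        characterDensity H ≤ max (characterDensity A) ℵ₀ := by
  classical
  let : PartialOrder A := CStarAlgebra.spectralOrder A
  have : StarOrderedRing A := CStarAlgebra.spectralOrderedRing A
  obtain ⟨D, hD, hcard⟩ := exists_dense_mk_eq_characterDensity A
  have hf : ∀ d : A, ∃ f : A →ₚ[ℂ] ℂ, ‖d‖ ≤ 2 * ‖f.gnsNonUnitalStarAlgHom d‖ := by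
    intro d
    rcases eq_or_ne d 0 with rfl | hd
    · exact ⟨0, by simp⟩
    · obtain ⟨f, hf⟩ := exists_positiveLinearMap_lt hd
      exact ⟨f, PositiveLinearMap.norm_le_norm_gns hf⟩
  choose f hf using hf
  let π := directSumRepresentation fun d : D ↦ (f d).gnsNonUnitalStarAlgHom
  refine ⟨lp (fun d : D ↦ (f d).GNS) 2, inferInstance, inferInstance, inferInstance, π, ?_, ?_⟩
  · rw [injective_iff_map_eq_zero]
    intro a ha
    have hzero : ∀ d : D, (f d).gnsNonUnitalStarAlgHom a = 0 := by
      intro d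
      ext v
      have := congrArg (fun T ↦ (T (lp.single 2 d v)) d) ha
      simpa [π, directSumRepresentation_apply] using this
    by_contra hne
    have hpos : 0 < ‖a‖ := norm_pos_iff.mpr hne
    obtain ⟨d, hd, had⟩ := hD.exists_dist_lt a (show 0 < ‖a‖ / 3 by positivity)
    rw [dist_eq_norm] at had
    have h₁ := hf d
    rw [show (f d).gnsNonUnitalStarAlgHom d = (f d).gnsNonUnitalStarAlgHom (d - a) by
      rw [map_sub, hzero ⟨d, hd⟩, sub_zero]] at h₁
    have h₂ := NonUnitalStarAlgHom.norm_apply_le (f d).gnsNonUnitalStarAlgHom (d - a)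
    rw [norm_sub_rev d a] at h₂
    have h₃ := norm_sub_norm_le a d
    linarith
  · have htotal := lp.dense_span_iUnion_single (G := fun d : D ↦ (f d).GNS)
      (fun d ↦ (fun a ↦ ((f d).toPreGNS a : (f d).GNS)) '' D) fun d ↦ (f d).dense_span_gns hD
    refine (characterDensity_le_of_dense_span htotal).trans (max_le ?_ (le_max_right _ _))
    rw [← hcard]
    refine (Cardinal.mk_iUnion_le _).trans ?_
    refine (mul_le_mul_right (ciSup_le' fun d ↦ Cardinal.mk_image_le.trans
      Cardinal.mk_image_le) _).trans ?_
    exact (Cardinal.mul_le_max _ _).trans (by simp)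

theorem exists_representationDensity_eq (A : Type u) [CStarAlgebra A] :
    ∃ (H : Type u) (_ : NormedAddCommGroup H) (_ : InnerProductSpace ℂ H) (_ : CompleteSpace H)
      (π : A →⋆ₙₐ[ℂ] (H →L[ℂ] H)), Function.Injective π ∧
        characterDensity H = representationDensity A := by
  obtain ⟨H, h₁, h₂, h₃, π, hπ, -⟩ := exists_faithful_representation A
  exact csInf_mem (s := {c : Cardinal.{u} |
    ∃ (H : Type u) (_ : NormedAddCommGroup H) (_ : InnerProductSpace ℂ H) (_ : CompleteSpace H)
      (π : A →⋆ₙₐ[ℂ] (H →L[ℂ] H)), Function.Injective π ∧ characterDensity H = c})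
    ⟨_, H, h₁, h₂, h₃, π, hπ, rfl⟩

theorem representationDensity_le (A : Type u) [CStarAlgebra A] :
    representationDensity A ≤ max (characterDensity A) ℵ₀ := by
  obtain ⟨H, h₁, h₂, h₃, π, hπ, hle⟩ := exists_faithful_representation A
  exact (csInf_le' (s := {c : Cardinal.{u} |
    ∃ (H : Type u) (_ : NormedAddCommGroup H) (_ : InnerProductSpace ℂ H) (_ : CompleteSpace H)
      (π : A →⋆ₙₐ[ℂ] (H →L[ℂ] H)), Function.Injective π ∧ characterDensity H = c})
    ⟨H, h₁, h₂, h₃, π, hπ, rfl⟩).trans hle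

theorem aleph0_le_representationDensity (A : Type u) [CStarAlgebra A] [Nontrivial A] :
    ℵ₀ ≤ representationDensity A := by
  obtain ⟨H, _, _, _, π, hπ, h⟩ := exists_representationDensity_eq A
  rw [← h]
  have : Nontrivial H := by
    by_contra hH
    rw [not_nontrivial_iff_subsingleton] at hH
    exact not_subsingleton A ⟨fun a b ↦ hπ (Subsingleton.elim _ _)⟩
  exact aleph0_le_characterDensity H

/-- A family `a x` in a C*-algebra, each member of which fails to commute with an element `b x`
commuting with all the other `a y`, is at most as large as the representation density. -/
theorem lift_mk_le_representationDensity {X : Type u} {A : Type w} [CStarAlgebra A]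
    (a b : X → A) (hne : ∀ x, a x * b x ≠ b x * a x)
    (hcomm : ∀ x y, x ≠ y → a y * b x = b x * a y) :
    Cardinal.lift.{w} #X ≤ Cardinal.lift.{u} (representationDensity A) := by
  obtain ⟨H, _, _, _, π, hπ, h⟩ := exists_representationDensity_eq A
  rw [← h]
  refine lift_mk_le_characterDensity (fun x ↦ π (a x)) (fun x ↦ π (b x)) (fun x ↦ ?_)
    fun x y hxy ↦ ?_
  · rw [← map_mul, ← map_mul]
    exact hπ.ne (hne x)
  · rw [← map_mul, ← map_mul, hcomm x y hxy]

end Rep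

theorem IsCStarTensorProduct.nontrivial_of_isEmpty {X : Type u} [IsEmpty X] {A : X → Type v}
    [∀ x, CStarAlgebra (A x)] {T : Type w} [CStarAlgebra T] {ι : ∀ x, A x →⋆ₐ[ℂ] T}
    (h : IsCStarTensorProduct ι) : Nontrivial T := by
  obtain ⟨Φ, -⟩ := h.universal C(PUnit.{max u v w + 1}, ℂ) isEmptyElim isEmptyElim
  exact Φ.toRingHom.domain_nontrivial

/-- Two elements of distinct factors commute, so noncommuting elements of the factors give
elements of the tensor product to which `lift_mk_le_representationDensity` applies. -/
theorem IsCStarTensorProduct.lift_mk_le_representationDensity {X : Type u} {A : X → Type v}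
    [∀ x, CStarAlgebra (A x)] {T : Type w} [CStarAlgebra T] {ι : ∀ x, A x →⋆ₐ[ℂ] T}
    (h : IsCStarTensorProduct ι) (s : Set X) (hs : ∀ x ∈ s, ∃ a b : A x, a * b ≠ b * a) :
    Cardinal.lift.{w} #s ≤ Cardinal.lift.{u} (representationDensity T) := by
  choose a b hab using fun x : s ↦ hs x x.2
  refine _root_.lift_mk_le_representationDensity (fun x : s ↦ ι x (a x)) (fun x ↦ ι x (b x))
    (fun x ↦ ?_) fun x y hxy ↦ h.commute _ _ (Subtype.coe_injective.ne hxy.symm) _ _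
  rw [← map_mul, ← map_mul]
  exact (h.injective x).ne (hab x)

theorem IsUHF.nontrivial {U : Type w} [CStarAlgebra U] (hU : IsUHF.{u, v, w} U) :
    Nontrivial U := by
  obtain ⟨X, M, _, ι, hM, h⟩ := hU
  rcases isEmpty_or_nonempty X with hX | ⟨⟨x⟩⟩
  · exact h.nontrivial_of_isEmpty
  · obtain ⟨n, hn, ⟨e⟩⟩ := hM x
    have : Nonempty (Fin n) := ⟨⟨0, hn⟩⟩
    have : Nontrivial (M x) := e.toEquiv.nontrivial
    exact (h.injective x).nontrivial

theorem IsUHF.characterDensity_le {U : Type w} [CStarAlgebra U] (hU : IsUHF.{u, v, w} U) :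
    characterDensity U ≤ representationDensity U := by
  have := hU.nontrivial
  have hinf := aleph0_le_representationDensity U
  obtain ⟨X, M, _, ι, hM, h⟩ := hU
  choose n hn e using hM
  replace e := fun x ↦ (e x).some
  let s : Set X := {x | 2 ≤ n x}
  let S : Set U := ⋃ x : s, Set.range fun p : Fin (n x) × Fin (n x) ↦
    ι x ((e x).symm (Matrix.single p.1 p.2 1))
  have hs : Cardinal.lift.{w} #s ≤ Cardinal.lift.{u} (representationDensity U) := by
    refine h.lift_mk_le_representationDensity s fun x hx ↦ ?_
    let i : Fin (n x) := ⟨0, hn x⟩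
    let j : Fin (n x) := ⟨1, hx⟩
    have hij : i ≠ j := by simp [i, j]
    refine ⟨(e x).symm (Matrix.single i j 1), (e x).symm (Matrix.single j i 1), ?_⟩
    rw [← map_mul, ← map_mul]
    refine (e x).symm.injective.ne fun heq ↦ ?_
    have := congrFun (congrFun heq i) i
    simp [hij.symm] at this
  have hS : Cardinal.lift.{u} #S ≤ Cardinal.lift.{u} (representationDensity U) := by
    refine (Cardinal.mk_iUnion_le_lift _).trans ?_
    have hsup : (⨆ x : s, Cardinal.lift.{u} #(Set.range fun p : Fin (n x) × Fin (n x) ↦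
        ι x ((e x).symm (Matrix.single p.1 p.2 1)))) ≤ ℵ₀ := by
      refine ciSup_le' fun x ↦ ?_
      rw [Cardinal.lift_le_aleph0, Cardinal.le_aleph0_iff_set_countable]
      exact Set.countable_range _
    refine (Cardinal.mul_le_max _ _).trans (max_le (max_le hs (hsup.trans ?_)) ?_) <;>
    simpa using hinf
  have hmem : ∀ x (m : M x), ι x m ∈ StarAlgebra.adjoin ℂ S := by
    intro x m
    rcases Nat.lt_or_ge (n x) 2 with hx | hx
    · have h1 : n x = 1 := le_antisymm (Nat.lt_succ_iff.mp hx) (hn x)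
      have hm : m = algebraMap ℂ (M x) (e x m ⟨0, hn x⟩ ⟨0, hn x⟩) := by
        apply EquivLike.injective (e x)
        rw [Algebra.algebraMap_eq_smul_one, map_smul, map_one]
        have : Subsingleton (Fin (n x)) := by rw [h1]; infer_instance
        ext i j
        obtain rfl := Subsingleton.elim i ⟨0, hn x⟩
        obtain rfl := Subsingleton.elim j ⟨0, hn x⟩
        simp
      rw [hm, AlgHomClass.commutes]
      exact algebraMap_mem _ _
    · have hm : m = ∑ i, ∑ j, e x m i j • (e x).symm (Matrix.single i j 1) := by
        apply EquivLike.injective (e x)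
        simp only [map_sum, map_smul, StarAlgEquiv.apply_symm_apply, Matrix.smul_single,
          smul_eq_mul, mul_one]
        exact Matrix.matrix_eq_sum_single _
      rw [hm]
      simp only [map_sum, map_smul]
      refine sum_mem fun i _ ↦ sum_mem fun j _ ↦ SMulMemClass.smul_mem _ ?_
      exact StarAlgebra.subset_adjoin ℂ S (Set.mem_iUnion.mpr ⟨⟨x, hx⟩, (i, j), rfl⟩)
  have htop : (StarAlgebra.adjoin ℂ S).topologicalClosure = ⊤ := by
    rw [eq_top_iff, ← h.generates]
    refine StarSubalgebra.topologicalClosure_mono (StarAlgebra.adjoin_le ?_)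
    refine Set.iUnion_subset fun x ↦ ?_
    rintro _ ⟨m, rfl⟩
    exact hmem x m
  exact (characterDensity_le_of_adjoin htop).trans (max_le (Cardinal.lift_le.mp hS) hinf)

theorem propositionP :
    (∀ (X : Type u) (A : X → Type v) [∀ x, CStarAlgebra (A x)] (T : Type w) [CStarAlgebra T]
        (ι : ∀ x, A x →⋆ₐ[ℂ] T),
        (∀ x, ∃ a b : A x, a * b ≠ b * a) →
        IsCStarTensorProduct ι →
        Cardinal.lift.{w} #X ≤ Cardinal.lift.{u} (representationDensity T)) ∧
    (∀ (U : Type w) [CStarAlgebra U], IsUHF.{u, v, w} U →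
        characterDensity U = representationDensity U) := by
  refine ⟨fun X A _ T _ ι hA h ↦ ?_, fun U _ hU ↦ le_antisymm hU.characterDensity_le ?_⟩
  · simpa using h.lift_mk_le_representationDensity Set.univ fun x _ ↦ hA x
  · have := hU.nontrivial
    exact (representationDensity_le U).trans (max_le le_rfl (aleph0_le_characterDensity U))
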